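/- All digraphs are finite and have a non-empty vertex set. Let $G$ be a digraph with vertex set $V(G)$ and arc set $E(G)$. For $W,X\subseteq V(G)$, the set $X$ *guards* $W$ if $W\cap X=\emptyset$ and every arc $(u,v)\in E(G)$ with $u\in W$ has $v\in W\cup X$. The set $W$ is *$X$-normal* if $W\cap X=\emptyset$ and no directed walk in $G\setminus X$ with first and last vertices in $W$ uses a vertex outside $W\cup X$. For $U\subseteq V(G)$ and $\alpha\in(0,1)$, an *$\alpha$-balanced directed vertex separator* of $U$ is a set $S\subseteq V(G)$ such that $V(G)\setminus S$ is the disjoint union of two (possibly empty) sets $U_1,U_2$, each containing at most $\alpha|U|$ vertices of $U$, such that $S$ guards $U_2$. Let $dsn_\alpha(G)$ be the least $k$ such that every $U\subseteq V(G)$ has an $\alpha$-balanced directed vertex separator of size at most $k$. For an acyclic digraph (DAG) $T$ and nodes $i,j$ of $T$, write $i\preceq j$ if there is a directed walk, possibly of length $0$, from $i$ to $j$. A *root* is a node without incoming arcs, and the *children* of $i$ are the heads of the arcs leaving $i$. The DAG $T$ is an *arborescence* if it has a unique root and there is a unique directed walk from the root to each node; it is a *directed path* if its nodes can be numbered $1,\dots,l$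 ($l\ge 1$) so that its arcs are exactly the pairs $(i,i+1)$. For a family $(W_i)_{i\in V(T)}$ of subsets of $V(G)$ put $W_{\succeq i}=\bigcup_{j\succeq i}W_j$. Below, a family *partitions* $V(G)$ if its members are pairwise disjoint, possibly empty, and have union $V(G)$. * A *DAG-decomposition* of $G$ is a DAG $T$ with sets $W_i\subseteq V(G)$ $(i\in V(T))$ such that $\bigcup_i W_i=V(G)$; $W_i\cap W_k\subseteq W_j$ whenever $i\preceq j\preceq k$; for each arc $(i,j)$ of $T$, $W_i\cap W_j$ guards $W_{\succeq j}\setminus W_i$; and for each root $r$, $\emptyset$ guards $W_{\succeq r}$. Its width is $\max_i|W_i|$. The *DAG-width* $dgw(G)$ is the minimum width of a DAG-decomposition of $G$, and the *directed pathwidth* $dpw(G)$ is the minimum width of a DAG-decomposition of $G$ for which $T$ is a directed path. * A *Kelly-decomposition* of $G$ is a DAG $T$ with sets $W_i,X_i\subseteq V(G)$ $(i\in V(T))$ such that $(W_i)$ partitions $V(G)$; each $X_i$ guards $W_{\succeq i}$; for each node $i$ its children can be enumerated as $j_1,\dots,j_s$ with $X_{j_q}\subseteq W_i\cup X_i\cup\bigcup_{p<q}W_{\succeq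 j_p}$ for all $q$; and the roots can be enumerated as $r_1,r_2,\dots$ with $X_{r_q}\subseteq\bigcup_{p<q}W_{\succeq r_p}$ for all $q$. Its width is $\max_i|W_i\cup X_i|$, and the *Kelly-width* $kw(G)$ is the minimum width of a Kelly-decomposition of $G$. * An *arboreal decomposition* of $G$ is an arborescence $T$ with sets $W_i\subseteq V(G)$ $(i\in V(T))$ and $X_e\subseteq V(G)$ $(e\in E(T))$ such that $(W_i)$ partitions $V(G)$ and, for each arc $e=(i,j)$ of $T$, $W_{\succeq j}$ is $X_e$-normal. Its width is $\max_i\bigl|W_i\cup\bigcup_{e\sim i}X_e\bigr|-1$, where $e\sim i$ means that $e$ is incident with $i$. The *directed treewidth* $dtw(G)$ is the minimum width of an arboreal decomposition of $G$. Then, for every digraph $G$, 1. $dsn_{3/4}(G)-1\le dtw(G)$; 2. $dsn_{3/4}(G)-2\le 3\cdot dgw(G)$; 3. $dsn_{3/4}(G)+1\le 6\cdot kw(G)$; 4. $dsn_{3/4}(G)-2\le 3\cdot dpw(G)$. -/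

import Mathlib

namespace DirectedWidth

universe u

/-! Digraphs are Mathlib's `Digraph V`, with `G.Adj u v` meaning that `(u, v)` is an arc. -/

section Basic

variable {V : Type u}

/-- `Reach G u v`: there is a directed walk (possibly of length zero) from `u` to `v`. -/
def Reach (G : Digraph V) (u v : V) : Prop := Relation.ReflTransGen G.Adj u v

/-- The arcs of `G \ X`, i.e. of the subdigraph induced on the complement of `X`. -/
def deleteVerts (G : Digraph V) (X : Set V) : Digraph V where
  Adj u v := G.Adj u v ∧ u ∉ X ∧ v ∉ X

/-- `X` guards `W` in `G`. -/
def Guards (G : Digraph V) (X W : Set V) : Prop :=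
  Disjoint W X ∧ ∀ u v, G.Adj u v → u ∈ W → v ∈ W ∪ X

/-- `W` is `X`-normal: `W` is disjoint from `X`, and no directed walk of `G \ X` starts in `W`,
visits a vertex `v` outside `W ∪ X`, and ends in `W`. -/
def Normal (G : Digraph V) (W X : Set V) : Prop :=
  Disjoint W X ∧ ¬ ∃ u v w, u ∈ W ∧ v ∉ W ∪ X ∧ w ∈ W ∧
    Reach (deleteVerts G X) u v ∧ Reach (deleteVerts G X) v w

/-- The indexed family `W` partitions the vertex set; members are allowed to be empty. -/
def IsPartition {ι : Type*} (W : ι → Set V) : Prop :=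
  Pairwise (fun i j => Disjoint (W i) (W j)) ∧ ⋃ i, W i = Set.univ

end Basic

section Shapes

variable {ι : Type*}

/-- No closed directed walk of positive length. -/
def IsDAG (T : Digraph ι) : Prop := ∀ i, ¬ Relation.TransGen T.Adj i i

/-- A root is a node without incoming arcs. -/
def IsRoot (T : Digraph ι) (r : ι) : Prop := ∀ i, ¬ T.Adj i r

/-- `p` is the list of nodes of a directed walk of `T` from `i` to `j`. -/
def IsWalk (T : Digraph ι) (i j : ι) (p : List ι) : Prop :=
  p.IsChain T.Adj ∧ p.head? = some i ∧ p.getLast? = some j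

/-- A DAG with a unique root, from which there is a unique directed walk to every node. -/
def IsArborescence (T : Digraph ι) : Prop :=
  IsDAG T ∧ ∃ r, (∀ i, IsRoot T i ↔ i = r) ∧ ∀ i, ∃! p : List ι, IsWalk T r i p

/-- The nodes can be numbered `0, …, l` so that the arcs are exactly the pairs `(i, i + 1)`. -/
def IsDirectedPath (T : Digraph ι) : Prop :=
  ∃ (l : ℕ) (e : ι ≃ Fin (l + 1)), ∀ i j, T.Adj i j ↔ (e i : ℕ) + 1 = (e j : ℕ)

/-- `W_{⪰ i}`: the union of the bags `W j` over all `j` reachable from `i`. -/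
def cone {V : Type*} (T : Digraph ι) (W : ι → Set V) (i : ι) : Set V :=
  {v | ∃ j, Reach T i j ∧ v ∈ W j}

end Shapes

section Widths

variable {V : Type u}

/-- A DAG-decomposition of `G`. -/
structure DagDecomposition (G : Digraph V) where
  node : Type
  finite : Finite node
  T : Digraph node
  isDAG : IsDAG T
  W : node → Set V
  cover : ⋃ i, W i = Set.univ
  convex : ∀ i j k, Reach T i j → Reach T j k → W i ∩ W k ⊆ W j
  guard : ∀ i j, T.Adj i j → Guards G (W i ∩ W j) (cone T W j \ W i)
  guard_root : ∀ r, IsRoot T r → Guards G ∅ (cone T W r)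

/-- The maximal size of a bag. -/
noncomputable def DagDecomposition.width {G : Digraph V} (D : DagDecomposition G) : ℕ :=
  ⨆ i, (D.W i).ncard

/-- DAG-width. -/
noncomputable def dgw (G : Digraph V) : ℕ := ⨅ D : DagDecomposition G, D.width

/-- Directed pathwidth: the minimal width of a DAG-decomposition whose underlying DAG is a
directed path (the width is the maximal bag size, one is not subtracted). -/
noncomputable def dpw (G : Digraph V) : ℕ :=
  ⨅ D : {D : DagDecomposition G // IsDirectedPath D.T}, D.1.width

/-- A Kelly-decomposition of `G`. -/
structure KellyDecomposition (G : Digraph V) where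
  node : Type
  finite : Finite node
  T : Digraph node
  isDAG : IsDAG T
  W : node → Set V
  X : node → Set V
  partition : IsPartition W
  guard : ∀ i, Guards G (X i) (cone T W i)
  /-- The children of `i` can be enumerated as `c[0], c[1], …` suitably. -/
  children : ∀ i, ∃ c : List node, c.Nodup ∧ (∀ j, j ∈ c ↔ T.Adj i j) ∧
    ∀ q : Fin c.length,
      X (c.get q) ⊆ W i ∪ X i ∪ ⋃ p : Fin c.length, ⋃ _ : p < q, cone T W (c.get p)
  /-- The roots can be enumerated as `c[0], c[1], …` suitably. -/
  roots : ∃ c : List node, c.Nodup ∧ (∀ r, r ∈ c ↔ IsRoot T r) ∧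
    ∀ q : Fin c.length,
      X (c.get q) ⊆ ⋃ p : Fin c.length, ⋃ _ : p < q, cone T W (c.get p)

/-- The maximal size of `W i ∪ X i`. -/
noncomputable def KellyDecomposition.width {G : Digraph V} (D : KellyDecomposition G) : ℕ :=
  ⨆ i, (D.W i ∪ D.X i).ncard

/-- Kelly-width. -/
noncomputable def kw (G : Digraph V) : ℕ := ⨅ D : KellyDecomposition G, D.width

/-- An arboreal decomposition of `G`. The arc bag of an arc `(i, j)` of `T` is `X i j`; the values
of `X` at pairs that are not arcs are never used. For the arc `e = (i, j)`, the set `W_{≻ e}` is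
`cone T W j`. -/
structure ArborealDecomposition (G : Digraph V) where
  node : Type
  finite : Finite node
  T : Digraph node
  isArborescence : IsArborescence T
  W : node → Set V
  X : node → node → Set V
  partition : IsPartition W
  normal : ∀ i j, T.Adj i j → Normal G (cone T W j) (X i j)

/-- `X_{∼ i}`: the union of the arc bags of all arcs incident with `i`. -/
def ArborealDecomposition.incident {G : Digraph V} (D : ArborealDecomposition G) (i : D.node) :
    Set V :=
  {v | ∃ a b, D.T.Adj a b ∧ (a = i ∨ b = i) ∧ v ∈ D.X a b}

/-- The maximal size of `W i ∪ X_{∼ i}`, minus one. -/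
noncomputable def ArborealDecomposition.width {G : Digraph V} (D : ArborealDecomposition G) : ℤ :=
  ((⨆ i, (D.W i ∪ D.incident i).ncard : ℕ) : ℤ) - 1

/-- Directed treewidth. -/
noncomputable def dtw (G : Digraph V) : ℤ := ⨅ D : ArborealDecomposition G, D.width

/-- `S` is an `α`-balanced directed vertex separator of `U` in `G`. -/
def IsBalancedSeparator (G : Digraph V) (α : ℝ) (U S : Set V) : Prop :=
  ∃ U₁ U₂ : Set V, U₁ ∪ U₂ = Sᶜ ∧ Disjoint U₁ U₂ ∧
    ((U₁ ∩ U).ncard : ℝ) ≤ α * (U.ncard : ℝ) ∧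
    ((U₂ ∩ U).ncard : ℝ) ≤ α * (U.ncard : ℝ) ∧
    Guards G S U₂

/-- The `α`-directed separator number: the least `k` such that every set of vertices has an
`α`-balanced directed vertex separator of size at most `k`. -/
noncomputable def dsn (α : ℝ) (G : Digraph V) : ℕ :=
  sInf {k : ℕ | ∀ U : Set V, ∃ S : Set V, IsBalancedSeparator G α U S ∧ S.ncard ≤ k}

end Widths

end DirectedWidth

namespace DirectedWidth

universe u

/-! ### Building balanced separators by enlarging guarded sets. -/

section Separators

variable {V : Type u}

/-! The bounds follow from stronger ones: `dsn (3 / 4) G` is at most `dgw G`, `kw G`, `dpw G` and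
`dtw G + 1`.

Given a decomposition and a set U, take a deepest node i whose cone holds more than half of U
(`IsDAG.exists_deepest`), and let S be the bag at i, joined with `X i` for Kelly-decompositions and
with the incident arc bags for arboreal ones. Then G \ S falls apart into pieces holding at most
half of U each. If no cone is that heavy, S is empty and, except in the arboreal case, the pieces
are the root cones.

The pieces are collected greedily into a set guarded by S. While more than 3/4 of U lies outside it
and S, it holds less than 1/4 of U, so one more piece keeps it below 3/4
(`isBalancedSeparator_of_extend`). The pieces are cones below i taken in a suitable order
(`isBalancedSeparator_of_family`) or strong components of G \ S (`isBalancedSeparator_of_strong`).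
-/

/-- The greedy step: arcs leaving the new piece may also end in what was collected before. Removing
S from C makes disjointness from S automatic. -/
theorem Guards.union {G : Digraph V} {S A C : Set V} (hA : Guards G S A)
    (hC : ∀ u v, G.Adj u v → u ∈ C → v ∈ C ∪ S ∪ A) : Guards G S (A ∪ C \ S) := by
  refine ⟨Set.disjoint_union_left.2 ⟨hA.1, Set.disjoint_sdiff_left⟩, fun u v huv hu => ?_⟩
  by_cases hvS : v ∈ S
  · exact Or.inr hvS
  refine Or.inl ?_
  rcases hu with hu | hu
  · exact Or.inl ((hA.2 u v huv hu).resolve_right hvS)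
  · rcases hC u v huv hu.1 with (h | h) | h
    · exact Or.inr ⟨h, hvS⟩
    · exact absurd h hvS
    · exact Or.inl h

theorem guards_empty (G : Digraph V) (S : Set V) : Guards G S ∅ :=
  ⟨Set.empty_disjoint _, fun _ _ _ h => absurd h (Set.notMem_empty _)⟩

theorem guards_compl (G : Digraph V) (S : Set V) : Guards G S Sᶜ :=
  ⟨disjoint_compl_left, fun _ v _ _ => (em (v ∈ S)).symm⟩

/-- If guarded sets leaving most of `U` outside can be enlarged in small steps, then `S` is a
balanced separator. -/
theorem isBalancedSeparator_of_extend [Finite V] {G : Digraph V} {U S : Set V}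
    (h : ∀ A, Guards G S A → 3 * U.ncard < 4 * ((A ∪ S)ᶜ ∩ U).ncard →
      ∃ B, A ⊂ B ∧ Guards G S B ∧ 2 * ((B \ A) ∩ U).ncard ≤ U.ncard) :
    IsBalancedSeparator G (3 / 4) U S := by
  -- A is maximal under inclusion among the guarded sets holding at most 3/4 of U. Too large a
  -- remainder would leave less than 1/4 of U in A, so B would contradict maximality.
  obtain ⟨A, ⟨hA, hAU⟩, hmax⟩ :=
    (Set.toFinite {A | Guards G S A ∧ 4 * (A ∩ U).ncard ≤ 3 * U.ncard}).exists_maximal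
      ⟨∅, guards_empty G S, by simp⟩
  have key : 4 * ((A ∪ S)ᶜ ∩ U).ncard ≤ 3 * U.ncard := by
    by_contra! hlt
    obtain ⟨B, hAB, hB, hBA⟩ := h A hA hlt
    have hBU : ¬ 4 * (B ∩ U).ncard ≤ 3 * U.ncard := fun hle =>
      hAB.not_subset (hmax ⟨hB, hle⟩ hAB.subset)
    have h1 : (B ∩ U).ncard ≤ (A ∩ U).ncard + ((B \ A) ∩ U).ncard := by
      refine (Set.ncard_le_ncard ?_).trans (Set.ncard_union_le _ _)
      rw [← Set.union_inter_distrib_right, Set.union_sdiff_self]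
      exact Set.inter_subset_inter_left _ Set.subset_union_right
    have h2 : (A ∩ U).ncard + ((A ∪ S)ᶜ ∩ U).ncard ≤ U.ncard := by
      rw [← Set.ncard_union_eq]
      · exact Set.ncard_le_ncard (Set.union_subset Set.inter_subset_right Set.inter_subset_right)
      · exact Set.disjoint_left.2 fun x hx hy => hy.1 (Or.inl hx.1)
    omega
  refine ⟨(A ∪ S)ᶜ, A, ?_, ?_, ?_, ?_, hA⟩
  · ext x
    have := fun h : x ∈ A => Set.disjoint_left.1 hA.1 h
    simp only [Set.mem_union, Set.mem_compl_iff]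
    tauto
  · exact Set.disjoint_left.2 fun x hx hy => hx (Or.inl hy)
  · have : (4 * ((A ∪ S)ᶜ ∩ U).ncard : ℝ) ≤ 3 * U.ncard := by exact_mod_cast key
    linarith
  · have : (4 * (A ∩ U).ncard : ℝ) ≤ 3 * U.ncard := by exact_mod_cast hAU
    linarith

/-- A family of small sets, each guarded by `S` and the earlier ones, that covers enough of `U`
yields a balanced separator. -/
theorem isBalancedSeparator_of_family [Finite V] {G : Digraph V} {U S : Set V} {κ : Type*}
    {r : κ → κ → Prop} (hr : WellFounded r) (C : κ → Set V)
    (hC : ∀ q u v, G.Adj u v → u ∈ C q → v ∈ C q ∪ S ∨ ∃ p, r p q ∧ v ∈ C p)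
    (hsmall : ∀ q, 2 * (C q ∩ U).ncard ≤ U.ncard)
    (hcover : 4 * ((S ∪ ⋃ q, C q)ᶜ ∩ U).ncard ≤ 3 * U.ncard) :
    IsBalancedSeparator G (3 / 4) U S := by
  refine isBalancedSeparator_of_extend fun A hA hlt => ?_
  have hne : {q | ¬ C q ⊆ A ∪ S}.Nonempty := by
    by_contra hcon
    have hsub : ∀ q, C q ⊆ A ∪ S := fun q => by
      by_contra hq
      exact hcon ⟨q, hq⟩
    have : ((A ∪ S)ᶜ ∩ U).ncard ≤ ((S ∪ ⋃ q, C q)ᶜ ∩ U).ncard := by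
      refine Set.ncard_le_ncard (Set.inter_subset_inter_left _ (Set.compl_subset_compl.2 ?_))
      exact Set.union_subset Set.subset_union_right (Set.iUnion_subset hsub)
    omega
  -- At a minimal piece not yet absorbed, all arcs to earlier pieces end in A or S.
  obtain ⟨q, hq, hmin⟩ := hr.has_min _ hne
  refine ⟨A ∪ C q \ S, ⟨Set.subset_union_left, fun hsub => hq fun x hx => ?_⟩,
    hA.union fun u v huv hu => ?_, ?_⟩
  · by_cases hxS : x ∈ S
    · exact Or.inr hxS
    · exact Or.inl (hsub (Or.inr ⟨hx, hxS⟩))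
  · rcases hC q u v huv hu with h | ⟨p, hp, hv⟩
    · exact Or.inl h
    · have hpA : C p ⊆ A ∪ S := by
        by_contra hcon
        exact hmin p hcon hp
      rcases hpA hv with h | h
      · exact Or.inr h
      · exact Or.inl (Or.inr h)
  · have : (((A ∪ C q \ S) \ A) ∩ U).ncard ≤ (C q ∩ U).ncard := by
      refine Set.ncard_le_ncard fun x hx => ⟨?_, hx.2⟩
      exact (hx.1.1.resolve_left hx.1.2).1
    exact (Nat.mul_le_mul_left 2 this).trans (hsmall q)

theorem not_mem_of_reach_deleteVerts {G : Digraph V} {S : Set V} {x y : V} (hx : x ∉ S)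
    (h : Reach (deleteVerts G S) x y) : y ∉ S := by
  rcases Relation.ReflTransGen.cases_tail h with rfl | ⟨_, _, h⟩
  · exact hx
  · exact h.2.2

theorem Reach.deleteVerts_mono {G : Digraph V} {S X : Set V} (hX : X ⊆ S) {x y : V}
    (h : Reach (deleteVerts G S) x y) : Reach (deleteVerts G X) x y :=
  Relation.ReflTransGen.mono
    (fun _ _ h => ⟨h.1, fun hx => h.2.1 (hX hx), fun hx => h.2.2 (hX hx)⟩) _ _ h

/-- If every strongly connected set of `G \ S` contains at most half of `U`, then `S` is a
balanced separator of `U`. -/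
theorem isBalancedSeparator_of_strong [Finite V] {G : Digraph V} {U S : Set V}
    (h : ∀ C : Set V, Disjoint C S → (∀ x ∈ C, ∀ y ∈ C, Reach (deleteVerts G S) x y) →
      2 * (C ∩ U).ncard ≤ U.ncard) :
    IsBalancedSeparator G (3 / 4) U S := by
  refine isBalancedSeparator_of_extend fun A hA hlt => ?_
  have hAS : A ⊂ Sᶜ := by
    refine ⟨fun x hx => Set.disjoint_left.1 hA.1 hx, fun hsub => ?_⟩
    have : (A ∪ S)ᶜ = ∅ := by
      rw [Set.compl_empty_iff, Set.eq_univ_iff_forall]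
      exact fun x => (em (x ∈ S)).elim Or.inr fun hx => Or.inl (hsub hx)
    simp [this] at hlt
  -- For a minimal guarded B above A, the difference B \ A is strongly connected in G \ S: adding to
  -- A everything reachable from any x in B \ A already gives a guarded set, hence all of B.
  obtain ⟨B, ⟨hB, hAB⟩, hmin⟩ :=
    (Set.toFinite {B | Guards G S B ∧ A ⊂ B}).exists_minimal ⟨Sᶜ, guards_compl G S, hAS⟩
  refine ⟨B, hAB, hB, h _ (hB.1.mono_left Set.sdiff_subset) fun x hx y hy => ?_⟩
  have hxS : x ∉ S := Set.disjoint_left.1 hB.1 hx.1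
  have hreach : ∀ z, Reach (deleteVerts G S) x z → z ∈ B := fun z hz => by
    induction hz with
    | refl => exact hx.1
    | tail _ hbc ih => exact (hB.2 _ _ hbc.1 ih).resolve_right hbc.2.2
  have hg : Guards G S (A ∪ {z | Reach (deleteVerts G S) x z} \ S) := by
    refine hA.union fun u v huv hu => ?_
    by_cases hv : v ∈ S
    · exact Or.inl (Or.inr hv)
    · exact Or.inl (Or.inl (hu.tail ⟨huv, not_mem_of_reach_deleteVerts hxS hu, hv⟩))
  have hsub := hmin (y := A ∪ {z | Reach (deleteVerts G S) x z} \ S)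
    ⟨hg, Set.subset_union_left, fun hs => hx.2 (hs (Or.inr ⟨.refl, hxS⟩))⟩
    (Set.union_subset hAB.subset fun z hz => hreach z hz.1)
  exact ((hsub hy.1).resolve_left hy.2).1

theorem dsn_le {α : ℝ} {G : Digraph V} {k : ℕ}
    (h : ∀ U, ∃ S, IsBalancedSeparator G α U S ∧ S.ncard ≤ k) : dsn α G ≤ k :=
  Nat.sInf_le h

end Separators

/-! ### Finite DAGs, cones and heavy nodes. -/

section Shapes

variable {ι : Type*} {T : Digraph ι}

theorem IsDAG.wellFounded [Finite ι] (hT : IsDAG T) : WellFounded T.Adj := by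
  have : IsTrans ι (Relation.TransGen T.Adj) := ⟨fun _ _ _ => Relation.TransGen.trans⟩
  have : Std.Irrefl (Relation.TransGen T.Adj) := ⟨hT⟩
  exact Subrelation.wf Relation.TransGen.single
    (Finite.wellFounded_of_trans_of_irrefl (Relation.TransGen T.Adj))

theorem IsDAG.wellFounded_swap [Finite ι] (hT : IsDAG T) :
    WellFounded (Function.swap T.Adj) := by
  refine IsDAG.wellFounded (T := ⟨Function.swap T.Adj⟩) fun i hi => hT i ?_
  exact Relation.transGen_swap.1 hi

theorem IsDAG.exists_root_reach [Finite ι] (hT : IsDAG T) (i : ι) :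
    ∃ r, IsRoot T r ∧ Reach T r i := by
  induction i using hT.wellFounded.induction with
  | _ i ih =>
    by_cases hi : IsRoot T i
    · exact ⟨i, hi, .refl⟩
    · obtain ⟨j, hj⟩ : ∃ j, T.Adj j i := by
        unfold IsRoot at hi
        push Not at hi
        exact hi
      obtain ⟨r, hr, hrj⟩ := ih j hj
      exact ⟨r, hr, hrj.tail hj⟩

/-- A property of nodes of a finite DAG either holds nowhere or holds at a node none of whose
children have it. -/
theorem IsDAG.exists_deepest [Finite ι] (hT : IsDAG T) (P : ι → Prop) :
    (∀ i, ¬ P i) ∨ ∃ i, P i ∧ ∀ j, T.Adj i j → ¬ P j := by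
  by_cases h : {i | P i}.Nonempty
  · obtain ⟨i, hi, hmin⟩ := hT.wellFounded_swap.has_min _ h
    exact Or.inr ⟨i, hi, fun j hij hj => hmin j hj hij⟩
  · exact Or.inl fun i hi => h ⟨i, hi⟩

variable {V : Type*} {W : ι → Set V}

theorem mem_cone {i : ι} {v : V} (h : v ∈ cone T W i) :
    v ∈ W i ∨ ∃ j, T.Adj i j ∧ v ∈ cone T W j := by
  obtain ⟨k, hik, hv⟩ := h
  rcases Relation.ReflTransGen.cases_head hik with rfl | ⟨j, hij, hjk⟩
  · exact Or.inl hv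
  · exact Or.inr ⟨j, hij, k, hjk, hv⟩

theorem IsDAG.exists_root_mem_cone [Finite ι] (hT : IsDAG T) (hW : ⋃ i, W i = Set.univ) (v : V) :
    ∃ r, IsRoot T r ∧ v ∈ cone T W r := by
  obtain ⟨i, hi⟩ := Set.mem_iUnion.1 (hW ▸ Set.mem_univ v)
  obtain ⟨r, hr, hri⟩ := hT.exists_root_reach i
  exact ⟨r, hr, i, hri, hi⟩

theorem four_mul_ncard_compl_le [Finite V] {U B D : Set V} (hB : U.ncard < 2 * (B ∩ U).ncard)
    (hBD : B ⊆ D) : 4 * (Dᶜ ∩ U).ncard ≤ 3 * U.ncard := by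
  have h1 : (Dᶜ ∩ U).ncard ≤ (U \ B).ncard :=
    Set.ncard_le_ncard fun x hx => ⟨hx.2, fun h => hx.1 (hBD h)⟩
  have h2 := Set.ncard_inter_add_ncard_sdiff_eq_ncard U B
  rw [Set.inter_comm] at h2
  omega

theorem le_iSup_of_finite [Finite ι] (f : ι → ℕ) (i : ι) : f i ≤ ⨆ i, f i :=
  le_ciSup (Set.finite_range f).bddAbove i

end Shapes

/-! ### The separator number is bounded by the width of each decomposition. -/

section Bounds

variable {V : Type u} [Finite V] {G : Digraph V}

theorem DagDecomposition.dsn_le_width (D : DagDecomposition G) : dsn (3 / 4) G ≤ D.width := by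
  have := D.finite
  refine dsn_le fun U => ?_
  -- The empty relation suffices as order: each piece is guarded by S alone.
  have hwf : ∀ κ : Type, WellFounded fun _ _ : κ => False :=
    fun κ => ⟨fun a => ⟨a, fun _ h => h.elim⟩⟩
  rcases D.isDAG.exists_deepest fun i => U.ncard < 2 * (cone D.T D.W i ∩ U).ncard with h | ⟨i, hi, h⟩
  · refine ⟨∅, isBalancedSeparator_of_family (hwf {r // IsRoot D.T r})
      (fun r => cone D.T D.W r.1) (fun q u v huv hu => Or.inl ((D.guard_root _ q.2).2 u v huv hu))
      (fun q => not_lt.1 (h q.1)) ?_, by simp⟩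
    have : (∅ ∪ ⋃ r : {r // IsRoot D.T r}, cone D.T D.W r.1) = Set.univ := by
      refine Set.eq_univ_of_forall fun v => Or.inr (Set.mem_iUnion.2 ?_)
      obtain ⟨r, hr, hv⟩ := D.isDAG.exists_root_mem_cone D.cover v
      exact ⟨⟨r, hr⟩, hv⟩
    rw [this]
    simp
  · refine ⟨D.W i, isBalancedSeparator_of_family (hwf {j // D.T.Adj i j})
      (fun j => cone D.T D.W j.1 \ D.W i) (fun q u v huv hu => Or.inl ?_)
      (fun q => ?_) (four_mul_ncard_compl_le hi fun v hv => ?_),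
      le_iSup_of_finite (fun i => (D.W i).ncard) i⟩
    · exact ((D.guard i q.1 q.2).2 u v huv hu).imp_right And.left
    · have : ((cone D.T D.W q.1 \ D.W i) ∩ U).ncard ≤ (cone D.T D.W q.1 ∩ U).ncard :=
        Set.ncard_le_ncard (Set.inter_subset_inter_left _ Set.sdiff_subset)
      have := h q.1 q.2
      omega
    · by_cases hvi : v ∈ D.W i
      · exact Or.inl hvi
      · obtain ⟨j, hij, hj⟩ := (mem_cone hv).resolve_left hvi
        exact Or.inr (Set.mem_iUnion.2 ⟨⟨j, hij⟩, hj, hvi⟩)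

/-- Here the order matters: the guard of a child's cone may use the cones of earlier siblings, which
is what the relation in `isBalancedSeparator_of_family` allows. -/
theorem KellyDecomposition.dsn_le_width (D : KellyDecomposition G) : dsn (3 / 4) G ≤ D.width := by
  have := D.finite
  refine dsn_le fun U => ?_
  have hwf (n : ℕ) : WellFounded fun p q : Fin n => p < q := wellFounded_lt
  rcases D.isDAG.exists_deepest fun i => U.ncard < 2 * (cone D.T D.W i ∩ U).ncard with h | ⟨i, hi, h⟩
  · obtain ⟨c, -, hc, hX⟩ := D.roots
    refine ⟨∅, isBalancedSeparator_of_family (hwf c.length)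
      (fun q => cone D.T D.W (c.get q)) (fun q u v huv hu => ?_)
      (fun q => not_lt.1 (h _)) ?_, by simp⟩
    · rcases (D.guard (c.get q)).2 u v huv hu with hv | hv
      · exact Or.inl (Or.inl hv)
      · obtain ⟨p, hp, hv⟩ := Set.mem_iUnion₂.1 (hX q hv)
        exact Or.inr ⟨p, hp, hv⟩
    · have : (∅ ∪ ⋃ q, cone D.T D.W (c.get q)) = Set.univ := by
        refine Set.eq_univ_of_forall fun v => Or.inr (Set.mem_iUnion.2 ?_)
        obtain ⟨r, hr, hv⟩ := D.isDAG.exists_root_mem_cone D.partition.2 v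
        obtain ⟨q, rfl⟩ := List.get_of_mem ((hc r).2 hr)
        exact ⟨q, hv⟩
      rw [this]
      simp
  · obtain ⟨c, -, hc, hX⟩ := D.children i
    refine ⟨D.W i ∪ D.X i, isBalancedSeparator_of_family (hwf c.length)
      (fun q => cone D.T D.W (c.get q)) (fun q u v huv hu => ?_)
      (fun q => not_lt.1 (h _ ((hc _).1 (List.get_mem c q))))
      (four_mul_ncard_compl_le hi fun v hv => ?_),
      le_iSup_of_finite (fun i => (D.W i ∪ D.X i).ncard) i⟩
    · rcases (D.guard (c.get q)).2 u v huv hu with hv | hv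
      · exact Or.inl (Or.inl hv)
      · rcases hX q hv with hv | hv
        · exact Or.inl (Or.inr hv)
        · obtain ⟨p, hp, hv⟩ := Set.mem_iUnion₂.1 hv
          exact Or.inr ⟨p, hp, hv⟩
    · rcases mem_cone hv with hv | ⟨j, hij, hj⟩
      · exact Or.inl (Or.inl hv)
      · obtain ⟨q, rfl⟩ := List.get_of_mem ((hc j).2 hij)
        exact Or.inr (Set.mem_iUnion.2 ⟨q, hj⟩)

/-- Absorbs the additive constant in the Kelly-width bound. -/
theorem KellyDecomposition.one_le_width [Nonempty V] (D : KellyDecomposition G) :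
    1 ≤ D.width := by
  have := D.finite
  obtain ⟨v⟩ := ‹Nonempty V›
  obtain ⟨i, hi⟩ := Set.mem_iUnion.1 (D.partition.2 ▸ Set.mem_univ v)
  have h : 0 < (D.W i ∪ D.X i).ncard := (Set.ncard_pos (Set.toFinite _)).2 ⟨v, Or.inl hi⟩
  exact h.trans_le (le_iSup_of_finite (fun i => (D.W i ∪ D.X i).ncard) i)

theorem ArborealDecomposition.dsn_le_width (D : ArborealDecomposition G) :
    (dsn (3 / 4) G : ℤ) - 1 ≤ D.width := by
  have := D.finite
  refine sub_le_sub_right (Int.ofNat_le.2 (dsn_le fun U => ?_)) 1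
  rcases D.isArborescence.1.exists_deepest
    fun i => U.ncard < 2 * (cone D.T D.W i ∩ U).ncard with h | ⟨i, hi, h⟩
  · refine ⟨∅, isBalancedSeparator_of_strong fun C _ _ => ?_, by simp⟩
    obtain ⟨r, hr, -⟩ := D.isArborescence.2
    have hcone : cone D.T D.W r = Set.univ := by
      refine Set.eq_univ_of_forall fun v => ?_
      obtain ⟨s, hs, hv⟩ := D.isArborescence.1.exists_root_mem_cone D.partition.2 v
      rwa [(hr s).1 hs] at hv
    have h1 := h r
    rw [hcone, Set.univ_inter] at h1
    have h2 : (C ∩ U).ncard ≤ U.ncard := Set.ncard_le_ncard Set.inter_subset_right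
    -- The root's cone is everything and holds at most half of U, so U is empty.
    omega
  · refine ⟨D.W i ∪ D.incident i, isBalancedSeparator_of_strong fun C hCS hC => ?_,
      le_iSup_of_finite (fun i => (D.W i ∪ D.incident i).ncard) i⟩
    -- By normality, a strongly connected set meeting a child's cone lies inside it, and that cone
    -- is light. Otherwise it avoids the whole cone of i, since S contains `D.W i`, and less than
    -- half of U remains.
    by_cases hj : ∃ j, D.T.Adj i j ∧ (C ∩ cone D.T D.W j).Nonempty
    · obtain ⟨j, hij, u, huC, huj⟩ := hj
      have hXS : D.X i j ⊆ D.W i ∪ D.incident i :=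
        fun v hv => Or.inr ⟨i, j, hij, Or.inl rfl, hv⟩
      have hsub : C ⊆ cone D.T D.W j := fun v hv => by
        by_contra hvj
        refine (D.normal i j hij).2 ⟨u, v, u, huj, ?_, huj, (hC u huC v hv).deleteVerts_mono hXS,
          (hC v hv u huC).deleteVerts_mono hXS⟩
        rintro (hv' | hv')
        · exact hvj hv'
        · exact Set.disjoint_left.1 hCS hv (hXS hv')
      have h1 : (C ∩ U).ncard ≤ (cone D.T D.W j ∩ U).ncard :=
        Set.ncard_le_ncard (Set.inter_subset_inter_left _ hsub)
      have := h j hij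
      omega
    · have h1 : (C ∩ U).ncard ≤ (U \ cone D.T D.W i).ncard := by
        refine Set.ncard_le_ncard fun v hv => ⟨hv.2, fun hvi => ?_⟩
        rcases mem_cone hvi with hw | ⟨j, hij, hvj⟩
        · exact Set.disjoint_left.1 hCS hv.1 (Or.inl hw)
        · exact hj ⟨j, hij, v, hv.1, hvj⟩
      have h2 := Set.ncard_inter_add_ncard_sdiff_eq_ncard U (cone D.T D.W i)
      rw [Set.inter_comm] at h2
      omega

end Bounds

/-! ### One-bag decompositions, showing that the infima defining the widths range over nonempty
families. -/

section Trivial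

variable {V : Type u} (G : Digraph V)

theorem isDAG_bot (ι : Type*) : IsDAG (⊥ : Digraph ι) := fun _ hi => by
  obtain ⟨_, h, _⟩ := Relation.TransGen.head'_iff.1 hi
  exact h

theorem isRoot_bot {ι : Type*} (r : ι) : IsRoot (⊥ : Digraph ι) r := fun _ h => h

theorem guards_univ : Guards G ∅ Set.univ :=
  ⟨Set.disjoint_empty _, fun _ _ _ _ => Or.inl trivial⟩

theorem isPartition_univ : IsPartition fun _ : Unit => (Set.univ : Set V) :=
  ⟨fun _ _ h => absurd rfl h, Set.iUnion_const _⟩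

theorem cone_univ {ι : Type*} (T : Digraph ι) (i : ι) :
    cone T (fun _ => (Set.univ : Set V)) i = Set.univ :=
  Set.eq_univ_of_forall fun _ => ⟨i, .refl, trivial⟩

/-- The decomposition with a single bag. -/
def DagDecomposition.trivial : DagDecomposition G where
  node := Unit
  finite := inferInstance
  T := ⊥
  isDAG := isDAG_bot _
  W _ := Set.univ
  cover := Set.iUnion_const _
  convex _ _ _ _ _ := Set.inter_subset_left
  guard _ _ h := h.elim
  guard_root r _ := by
    rw [cone_univ]
    exact guards_univ G

theorem DagDecomposition.isDirectedPath_trivial :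
    IsDirectedPath (DagDecomposition.trivial G).T :=
  ⟨0, (Equiv.ofUnique Unit (Fin 1)), fun i j => ⟨fun h => h.elim, fun h => by
    have hj := ((Equiv.ofUnique Unit (Fin 1)) j).2
    omega⟩⟩

/-- The Kelly-decomposition with a single bag. -/
def KellyDecomposition.trivial : KellyDecomposition G where
  node := Unit
  finite := inferInstance
  T := ⊥
  isDAG := isDAG_bot _
  W _ := Set.univ
  X _ := ∅
  partition := isPartition_univ
  guard i := by
    rw [cone_univ]
    exact guards_univ G
  children i := ⟨[], List.nodup_nil, fun j => ⟨fun h => absurd h List.not_mem_nil, fun h => h.elim⟩,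
    fun q => q.elim0⟩
  roots := ⟨[()], List.nodup_singleton _,
    fun r => ⟨fun _ => isRoot_bot r, fun _ => List.mem_singleton.2 rfl⟩,
    fun _ => Set.empty_subset _⟩

theorem isWalk_bot_unit : ∃! p : List Unit, IsWalk (⊥ : Digraph Unit) () () p := by
  refine ⟨[()], ⟨List.isChain_singleton _, rfl, rfl⟩, fun p hp => ?_⟩
  match p, hp with
  | [], hp => exact absurd hp.2.1 (by simp)
  | [()], _ => rfl
  | a :: b :: l, hp => exact ((List.isChain_cons_cons.1 hp.1).1).elim

/-- The arboreal decomposition with a single bag. -/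
def ArborealDecomposition.trivial : ArborealDecomposition G where
  node := Unit
  finite := inferInstance
  T := ⊥
  isArborescence := ⟨isDAG_bot _, (), fun i => ⟨fun _ => rfl, fun _ => isRoot_bot i⟩,
    fun _ => isWalk_bot_unit⟩
  W _ := Set.univ
  X _ _ := ∅
  partition := isPartition_univ
  normal _ _ h := h.elim

end Trivial

/-! ### Passing to the infimum over decompositions. -/

section Widths

variable {V : Type u} [Finite V] (G : Digraph V)

theorem dsn_sub_one_le_dtw : (dsn (3 / 4) G : ℤ) - 1 ≤ dtw G :=
  have : Nonempty (ArborealDecomposition G) := ⟨.trivial G⟩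
  le_ciInf fun D => D.dsn_le_width

theorem dsn_le_dgw : dsn (3 / 4) G ≤ dgw G :=
  have : Nonempty (DagDecomposition G) := ⟨.trivial G⟩
  le_ciInf fun D => D.dsn_le_width

theorem dsn_le_dpw : dsn (3 / 4) G ≤ dpw G :=
  have : Nonempty {D : DagDecomposition G // IsDirectedPath D.T} :=
    ⟨.trivial G, DagDecomposition.isDirectedPath_trivial G⟩
  le_ciInf fun D => D.1.dsn_le_width

theorem dsn_le_kw : dsn (3 / 4) G ≤ kw G :=
  have : Nonempty (KellyDecomposition G) := ⟨.trivial G⟩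
  le_ciInf fun D => D.dsn_le_width

theorem one_le_kw [Nonempty V] : 1 ≤ kw G :=
  have : Nonempty (KellyDecomposition G) := ⟨.trivial G⟩
  le_ciInf fun D => D.one_le_width

end Widths

end DirectedWidth

theorem mainTheorem5 {V : Type*} [Finite V] [Nonempty V] (G : Digraph V) :
    (DirectedWidth.dsn (3 / 4) G : ℤ) - 1 ≤ DirectedWidth.dtw G ∧
    (DirectedWidth.dsn (3 / 4) G : ℤ) - 2 ≤ 3 * (DirectedWidth.dgw G : ℤ) ∧
    (DirectedWidth.dsn (3 / 4) G : ℤ) + 1 ≤ 6 * (DirectedWidth.kw G : ℤ) ∧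
    (DirectedWidth.dsn (3 / 4) G : ℤ) - 2 ≤ 3 * (DirectedWidth.dpw G : ℤ) := by
  have h1 := DirectedWidth.dsn_le_dgw G
  have h2 := DirectedWidth.dsn_le_kw G
  have h3 := DirectedWidth.one_le_kw G
  have h4 := DirectedWidth.dsn_le_dpw G
  -- Only the Kelly bound needs positivity: `dsn + 1 ≤ kw + 1 ≤ 6 * kw` uses `1 ≤ kw`.
  refine ⟨DirectedWidth.dsn_sub_one_le_dtw G, ?_, ?_, ?_⟩ <;> omega
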